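/- All graphs are finite, simple and undirected. A star is a graph $K_{1,m}$ with $m\ge 0$ (so a single vertex and a single edge are stars), and a non-star tree is a tree that is not a star. For a tree $T$, $\mathrm{dist}$ denotes the distance in $T$, $d(y)$ the degree of $y$ in $T$, and $T^6$ the graph on $V(T)$ in which two distinct vertices are adjacent when their distance in $T$ is at most $6$. For a permutation $\sigma$ of $V(T)$, $\sigma(T)$ is the graph on $V(T)$ with edge set $\{\sigma(u)\sigma(v) : uv\in E(T)\}$. **Theorem 1.7.** Let $T$ be a non-star tree and let $x$ be a vertex of $T$. Then there exists a $(T,x)$-well 2-placement, that is, a permutation $\sigma$ of $V(T)$ with $\sigma(v)\ne v$ for every $v\in V(T)$ such that: 1. $\sigma$ is a 2-placement of $T$, i.e. $E(T)\cap E(\sigma(T))=\emptyset$; 2. $\sigma(T)\subseteq T^6$, i.e. every edge of $\sigma(T)$ is an edge of $T^6$; 3. $\mathrm{dist}(x,\sigma(x))\le 2$; 4. $\mathrm{dist}(y,\sigma(y))\le 3$ for every neighbour $y$ of $x$; 5. $\mathrm{dist}(y,\sigma(y))\le 4$ for every vertex $y$ with $d(y)=1$; 6. every cycle of $\sigma$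 has length at most $5$. -/

import Mathlib

namespace TreePacking

/-- A star: the complete bipartite graph `K_{1,m}` for some `m ≥ 0`, with centre `c`
(a single vertex and a single edge are stars). -/
def IsStar {V : Type*} (G : SimpleGraph V) : Prop :=
  ∃ c : V, ∀ u v : V, G.Adj u v ↔ u ≠ v ∧ (u = c ∨ v = c)

/-- The `k`-th power of a graph: distinct vertices are adjacent when they are joined by a path
and their distance in `G` is at most `k`. -/
def graphPower {V : Type*} (G : SimpleGraph V) (k : ℕ) : SimpleGraph V where
  Adj u v := u ≠ v ∧ G.Reachable u v ∧ G.dist u v ≤ k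
  symm := ⟨fun _ _ h => ⟨h.1.symm, h.2.1.symm, by rw [SimpleGraph.dist_comm]; exact h.2.2⟩⟩
  loopless := ⟨fun _ h => h.1 rfl⟩

/-- The image `σ(G)` of a graph under a permutation of its vertices: its edges are the pairs
`σ(x)σ(y)` with `xy` an edge of `G`. -/
def image {V : Type*} (σ : Equiv.Perm V) (G : SimpleGraph V) : SimpleGraph V :=
  G.map σ.toEmbedding

/-- `σ` is a 2-placement of `G`: the copies `G` and `σ(G)` share no edge. -/
def IsTwoPlacement {V : Type*} (G : SimpleGraph V) (σ : Equiv.Perm V) : Prop :=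
  Disjoint G.edgeSet (image σ G).edgeSet

/-- `σ` is a `(T,x)`-well 2-placement. -/
structure IsWellTwoPlacement {V : Type*} [Fintype V] [DecidableEq V] (T : SimpleGraph V)
    [DecidableRel T.Adj] (x : V) (σ : Equiv.Perm V) : Prop where
  fixedPointFree : ∀ v : V, σ v ≠ v
  isTwoPlacement : IsTwoPlacement T σ
  image_le : image σ T ≤ graphPower T 6
  dist_base : T.dist x (σ x) ≤ 2
  dist_neighbor : ∀ y : V, T.Adj x y → T.dist y (σ y) ≤ 3
  dist_leaf : ∀ y : V, T.degree y = 1 → T.dist y (σ y) ≤ 4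
  /-- `cycleType` lists the lengths of the nontrivial cycles of `σ`. -/
  cycle_length : ∀ l ∈ σ.cycleType, l ≤ 5

end TreePacking

namespace TreePacking

/-! The proof builds the tree by attaching gadgets. A gadget is a small set of branches at a vertex
`v` that has a placement of its own, with `v` fixed, sending the neighbours of `v` to within
distance 2 of `v`. The gadgets are two path branches with at most three vertices each, or one path
branch with four vertices.

If the part `R` containing `v` is placed by `σ` and the gadget by `τ`, the product of these disjoint
permutations places the union. A joining edge `vd` goes to `σ(v)τ(d)`. This is not an edge, because
only `v` is joined to the gadget and `σ(v) ≠ v`. Its ends are at distance at most 4 + 2 = 6, since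
every vertex, not only a leaf, is moved by at most 4 (`WellPlaced.step`).

Every tree rooted at `x` arises by such steps from a path with at most four vertices ending at `x`
(`Rooted.exists_steps`). The four-vertex path has a placement; shorter ones are stars. A gadget
attached to a star gives either a star or, by a finite table, a placed tree (`StarOn.step`). The
table is finite because surplus leaves of the star come off in pairs, each pair being a gadget at
the centre. Hence every tree is a star or has a placement. -/

/-! ### Trees encoded by parent lists. -/

/-- The list `l` of vertices induces in `G` the tree in which the parent of the `j`-th vertex, for
`j > 0`, is the vertex of index `par[j]`. -/
structure Realizes {V : Type*} (G : SimpleGraph V) (par : List ℕ) (l : List V) : Prop where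
  nodup : l.Nodup
  length_eq : l.length = par.length
  adj_iff : ∀ (i j : ℕ) (hi : i < l.length) (hj : j < l.length), i < j →
    (G.Adj l[i] l[j] ↔ par.getD j 0 = i)

/-- The parent list of the path with `n` vertices, rooted at an end. -/
def pathParents (n : ℕ) : List ℕ := (List.range n).map (· - 1)

/-- The parent list obtained by identifying the root of the tree `q` with the vertex of index `k`
of the tree `p`. -/
def glueParents (p q : List ℕ) (k : ℕ) : List ℕ :=
  p ++ q.tail.map fun i => if i = 0 then k else i - 1 + p.length

theorem pathParents_getD {n j : ℕ} (hj : j < n) : (pathParents n).getD j 0 = j - 1 := by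
  simp [pathParents, List.getD_eq_getElem?_getD, hj]

theorem Realizes.glue {V : Type*} {G : SimpleGraph V} {p q : List ℕ} {l ls : List V} {v : V} {k : ℕ}
    (hp : Realizes G p l) (hq : Realizes G q (v :: ls)) (hk : k < l.length) (hv : l[k] = v)
    (hc : ∀ r ∈ l, ∀ d ∈ ls, r ≠ d ∧ (G.Adj r d → r = v)) :
    Realizes G (glueParents p q k) (l ++ ls) := by
  obtain ⟨q0, qs, rfl⟩ : ∃ q0 qs, q = q0 :: qs := by
    cases q with
    | nil => simpa using hq.length_eq
    | cons a b => exact ⟨a, b, rfl⟩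
  have hlp := hp.length_eq
  have hlq : ls.length = qs.length := by simpa using hq.length_eq
  have hnd := List.nodup_cons.1 hq.nodup
  -- The root of `q` is absorbed into vertex `k`, so the other indices of `q` drop by one before
  -- being shifted past `p`.
  have hpar : ∀ j, j < qs.length → (glueParents p (q0 :: qs) k).getD (j + l.length) 0 =
      if qs.getD j 0 = 0 then k else qs.getD j 0 - 1 + l.length := by
    intro j hj
    rw [glueParents, List.getD_append_right _ _ _ _ (by omega)]
    simp [List.getD_eq_getElem?_getD, hlp, hj]
  refine ⟨List.nodup_append.2 ⟨hp.nodup, hnd.2, fun a ha b hb => (hc a ha b hb).1⟩, ?_, ?_⟩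
  · simp [glueParents, hlp, hlq]
  · intro i j hi hj hij
    simp only [List.length_append] at hi hj
    rcases lt_or_ge j l.length with hjl | hjl
    · rw [List.getElem_append_left (hij.trans hjl), List.getElem_append_left hjl,
        hp.adj_iff i j _ hjl hij, glueParents, List.getD_append _ _ _ _ (by omega)]
    · obtain ⟨j', rfl⟩ := Nat.exists_eq_add_of_le' hjl
      have hj' : j' < ls.length := by omega
      rw [hpar j' (by omega), List.getElem_append_right (i := j' + l.length) (by omega)]
      simp only [Nat.add_sub_cancel]
      rcases lt_or_ge i l.length with hil | hil
      · rw [List.getElem_append_left hil]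
        have h0 := hq.adj_iff 0 (j' + 1) (by simp) (by simpa using hj') (by omega)
        simp only [List.getElem_cons_zero, List.getElem_cons_succ, List.getD_cons_succ] at h0
        constructor
        · intro h
          have hiv := (hc _ (List.getElem_mem hil) _ (List.getElem_mem hj')).2 h
          have hik : i = k := (hp.nodup.getElem_inj_iff).1 (hiv.trans hv.symm)
          rw [hiv, h0] at h
          rw [if_pos h, hik]
        · intro h
          split_ifs at h with h1
          · subst h
            rw [hv]
            exact h0.2 h1
          · omega
      · obtain ⟨i', rfl⟩ := Nat.exists_eq_add_of_le' hil
        rw [List.getElem_append_right (i := i' + l.length) (by omega)]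
        simp only [Nat.add_sub_cancel]
        have h0 := hq.adj_iff (i' + 1) (j' + 1) (by simp; omega) (by simpa using hj') (by omega)
        simp only [List.getElem_cons_succ, List.getD_cons_succ] at h0
        rw [h0]
        split_ifs <;> omega

theorem Realizes.cons_path {V : Type*} {G : SimpleGraph V} {n : ℕ} {x y : V} {ys : List V}
    (h : Realizes G (pathParents n) (y :: ys)) (hxy : G.Adj x y) (hx : x ∉ ys)
    (hxs : ∀ d ∈ ys, ¬ G.Adj x d) : Realizes G (pathParents (n + 1)) (x :: y :: ys) := by
  have hn : ys.length + 1 = n := by simpa [pathParents] using h.length_eq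
  refine ⟨List.nodup_cons.2 ⟨by simp [hxy.ne, hx], h.nodup⟩, by simp [pathParents, ← hn], ?_⟩
  intro i j hi hj hij
  simp only [List.length_cons] at hi hj
  rw [pathParents_getD (by omega)]
  obtain ⟨j, rfl⟩ := Nat.exists_eq_succ_of_ne_zero (n := j) (by omega)
  rcases i with _ | i
  · rcases j with _ | j
    · simpa using hxy
    · simpa using hxs _ (List.getElem_mem _)
  · have := h.adj_iff i j (by simp; omega) (by simp; omega) (by omega)
    rw [pathParents_getD (by omega)] at this
    simp only [List.getElem_cons_succ]
    rw [this]
    omega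

theorem Realizes.singleton {V : Type*} (G : SimpleGraph V) (x : V) :
    Realizes G (pathParents 1) [x] := by
  refine ⟨by simp, by simp [pathParents], fun i j hi hj hij => ?_⟩
  simp at hj
  omega

/-! ### Decidable conditions for placements of encoded trees. -/

/-- An upper bound for distances in the tree with parent list `par`, with recursion depth `k`. -/
def treeDist (par : List ℕ) : ℕ → ℕ → ℕ → ℕ
  | 0, _, _ => 100
  | k + 1, i, j =>
    if i = j then 0
    else if i < j then treeDist par k i (par.getD j 0) + 1
    else treeDist par k (par.getD i 0) j + 1

/-- Adjacency of indices in the tree with parent list `par`. -/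
def treeAdj (par : List ℕ) (i j : ℕ) : Prop :=
  (i < j ∧ par.getD j 0 = i) ∨ (j < i ∧ par.getD i 0 = j)

instance (par : List ℕ) (i j : ℕ) : Decidable (treeAdj par i j) := by
  unfold treeAdj; infer_instance

/-- The conditions on the vertex of index `i`, and on the edge to its parent, for `p` to be a
placement of the part of the tree `par` of indices at least `m`. -/
def IsPlacementAt (par p : List ℕ) (m i : ℕ) : Prop :=
  p.getD i 0 ≠ i ∧ treeDist par 20 i (p.getD i 0) ≤ 4 ∧
    (∃ k < 5, (fun a => p.getD a 0)^[k + 1] i = i) ∧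
    (0 < i → m ≤ par.getD i 0 →
      ¬ treeAdj par (p.getD i 0) (p.getD (par.getD i 0) 0) ∧
      treeDist par 20 (p.getD i 0) (p.getD (par.getD i 0) 0) ≤ 6)

instance (par p : List ℕ) (m i : ℕ) : Decidable (IsPlacementAt par p m i) := by
  unfold IsPlacementAt; infer_instance

/-- The list `p` encodes a permutation of the indices of the tree `par` that fixes the indices below
`m` and is a placement of the forest formed by the other ones. -/
def IsPlacementList (par p : List ℕ) (m : ℕ) : Prop :=
  p.length = par.length ∧ p.Nodup ∧ (∀ i < m, p.getD i 0 = i) ∧ ∀ i < par.length,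
    p.getD i 0 < par.length ∧ (0 < i → par.getD i 0 < i) ∧ (m ≤ i → IsPlacementAt par p m i)

instance (par p : List ℕ) (m : ℕ) : Decidable (IsPlacementList par p m) := by
  unfold IsPlacementList; infer_instance

/-- The list `p` encodes a placement of the tree `par` that moves the vertex of index `x` and its
neighbours by little. -/
def IsWellPlacementList (par p : List ℕ) (x : ℕ) : Prop :=
  IsPlacementList par p 0 ∧ treeDist par 20 x (p.getD x 0) ≤ 2 ∧
    ∀ i < par.length, treeAdj par x i → treeDist par 20 i (p.getD i 0) ≤ 3

instance (par p : List ℕ) (x : ℕ) : Decidable (IsWellPlacementList par p x) := by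
  unfold IsWellPlacementList; infer_instance

/-- The list `p` encodes a placement of the branches at the root of the tree `par`. -/
def IsGadgetList (par p : List ℕ) : Prop :=
  IsPlacementList par p 1 ∧
    ∀ i < par.length, 0 < i → par.getD i 0 = 0 → treeDist par 20 0 (p.getD i 0) ≤ 2

instance (par p : List ℕ) : Decidable (IsGadgetList par p) := by
  unfold IsGadgetList; infer_instance

/-! ### Transfer from encoded trees to graphs. -/

/-- `σ` moves exactly the vertices of `S`, and it is a placement of the graph induced by `S` with
small displacements and short cycles. -/
structure PlacedOn {V : Type*} (G : SimpleGraph V) (S : Finset V) (σ : Equiv.Perm V) : Prop where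
  ne_iff : ∀ v, σ v ≠ v ↔ v ∈ S
  not_adj : ∀ u ∈ S, ∀ v ∈ S, G.Adj u v → ¬ G.Adj (σ u) (σ v)
  dist_le_six : ∀ u ∈ S, ∀ v ∈ S, G.Adj u v → G.dist (σ u) (σ v) ≤ 6
  dist_le_four : ∀ v ∈ S, G.dist v (σ v) ≤ 4
  period : ∀ v, ∃ k < 5, σ^[k + 1] v = v

/-- There is a placement of the graph induced by `S` that moves `x` and its neighbours by little. -/
def WellPlaced {V : Type*} (G : SimpleGraph V) (S : Finset V) (x : V) : Prop :=
  ∃ σ : Equiv.Perm V, PlacedOn G S σ ∧ G.dist x (σ x) ≤ 2 ∧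
    ∀ y ∈ S, G.Adj x y → G.dist y (σ y) ≤ 3

theorem Realizes.exists_fun {V : Type*} {G : SimpleGraph V} {par : List ℕ} {l : List V}
    (h : Realizes G par l) (hl : l ≠ []) : ∃ f : ℕ → V,
      (∀ i (hi : i < l.length), f i = l[i]) ∧ (∀ v, v ∈ l ↔ ∃ i < par.length, f i = v) ∧
      (∀ i < par.length, ∀ j < par.length, f i = f j → i = j) ∧
      ∀ i < par.length, ∀ j < par.length, (G.Adj (f i) (f j) ↔ treeAdj par i j) := by
  have hf : ∀ i (hi : i < l.length), (fun i => l.getD i (l.head hl)) i = l[i] := fun i hi => by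
    simp [List.getD_eq_getElem?_getD, hi]
  refine ⟨fun i => l.getD i (l.head hl), hf, ?_, ?_, ?_⟩
  · intro v
    rw [List.mem_iff_getElem, ← h.length_eq]
    constructor
    · rintro ⟨i, hi, rfl⟩; exact ⟨i, hi, hf i hi⟩
    · rintro ⟨i, hi, rfl⟩; exact ⟨i, hi, (hf i hi).symm⟩
  · rw [← h.length_eq]
    intro i hi j hj hij
    rw [hf i hi, hf j hj] at hij
    exact (h.nodup.getElem_inj_iff).1 hij
  · rw [← h.length_eq]
    intro i hi j hj
    rw [hf i hi, hf j hj, treeAdj]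
    rcases lt_trichotomy i j with hij | rfl | hij
    · rw [h.adj_iff i j hi hj hij]; omega
    · simp
    · rw [G.adj_comm, h.adj_iff j i hj hi hij]; omega

/-- Each recursion step replaces the larger index by its parent, an adjacent vertex, so the triangle
inequality applies. The value 100 marks exhausted recursion depth. It carries no information and is
excluded by the bound; the conditions checked later are all at most 6. -/
theorem dist_le_treeDist {V : Type*} {G : SimpleGraph V} (hG : G.Connected) {par : List ℕ}
    {f : ℕ → V} (hp : ∀ i < par.length, 0 < i → par.getD i 0 < i)
    (hf : ∀ i < par.length, ∀ j < par.length, (G.Adj (f i) (f j) ↔ treeAdj par i j)) (k : ℕ) :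
    ∀ i < par.length, ∀ j < par.length, treeDist par k i j < 100 →
      G.dist (f i) (f j) ≤ treeDist par k i j := by
  have hpar : ∀ i < par.length, 0 < i → G.dist (f i) (f (par.getD i 0)) ≤ 1 := fun i hi h0 => by
    have := hp i hi h0
    refine (SimpleGraph.dist_eq_one_iff_adj.2 ((hf _ hi _ (by omega)).2 ?_)).le
    exact Or.inr ⟨this, rfl⟩
  induction k with
  | zero => intro i _ j _ h; simp [treeDist] at h
  | succ k ih =>
    intro i hi j hj h
    rw [treeDist] at h ⊢
    split_ifs at h ⊢ with h1 h2
    · simp [h1]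
    · have h3 := hp j hj (by omega)
      have h4 := ih i hi (par.getD j 0) (by omega) (by omega)
      have h5 := hpar j hj (by omega)
      rw [SimpleGraph.dist_comm] at h5
      exact (hG.dist_triangle (v := f (par.getD j 0))).trans (by omega)
    · have h3 := hp i hi (by omega)
      have h4 := ih (par.getD i 0) (by omega) j hj (by omega)
      have h5 := hpar i hi (by omega)
      exact (hG.dist_triangle (v := f (par.getD i 0))).trans (by omega)

theorem exists_perm_of_list {V : Type*} {n : ℕ} {f : ℕ → V} {p : List ℕ}
    (hf : ∀ i < n, ∀ j < n, f i = f j → i = j) (hlen : p.length = n) (hnd : p.Nodup)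
    (hp : ∀ i < n, p.getD i 0 < n) : ∃ σ : Equiv.Perm V,
      (∀ i < n, σ (f i) = f (p.getD i 0)) ∧ ∀ v, (∀ i < n, f i ≠ v) → σ v = v := by
  let F : Fin n ↪ V := ⟨fun i => f i, fun i j h => Fin.ext (hf i i.2 j j.2 h)⟩
  let P : Fin n → Fin n := fun i => ⟨p.getD i 0, hp i i.2⟩
  have hP : Function.Injective P := by
    intro i j hij
    have h1 : p.getD i 0 = p.getD j 0 := congrArg Fin.val hij
    rw [List.getD_eq_getElem _ _ (by omega), List.getD_eq_getElem _ _ (by omega)] at h1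
    exact Fin.ext ((hnd.getElem_inj_iff).1 h1)
  let e : Equiv.Perm (Fin n) := Equiv.ofBijective P (Finite.injective_iff_bijective.1 hP)
  refine ⟨e.viaEmbedding F, fun i hi => ?_, fun v hv => ?_⟩
  · exact Equiv.Perm.viaEmbedding_apply e F ⟨i, hi⟩
  · exact Equiv.Perm.viaEmbedding_apply_of_notMem e F v (by rintro ⟨i, rfl⟩; exact hv i i.2 rfl)

/-- Every edge of the encoded tree joins a vertex to its parent, so checking parent edges suffices.
The value `m = 0` serves whole trees; `m = 1` serves gadgets, whose root stays fixed and whose root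
edges are exempt. -/
theorem IsPlacementList.exists_placedOn {V : Type*} [DecidableEq V] {G : SimpleGraph V}
    (hG : G.Connected) {par p : List ℕ} {m : ℕ} {f : ℕ → V} (h : IsPlacementList par p m)
    (hinj : ∀ i < par.length, ∀ j < par.length, f i = f j → i = j)
    (hf : ∀ i < par.length, ∀ j < par.length, (G.Adj (f i) (f j) ↔ treeAdj par i j))
    {S : Finset V} (hS : ∀ v, v ∈ S ↔ ∃ i < par.length, m ≤ i ∧ f i = v) :
    ∃ σ : Equiv.Perm V, PlacedOn G S σ ∧ ∀ i < par.length, σ (f i) = f (p.getD i 0) := by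
  obtain ⟨hlen, hnd, hfix, hall⟩ := h
  obtain ⟨σ, hσ, hσ'⟩ := exists_perm_of_list hinj hlen hnd (fun i hi => (hall i hi).1)
  have hd := dist_le_treeDist hG (fun i hi => (hall i hi).2.1) hf
  -- The condition `0 < i` discards the root, whose own parent entry stands for no edge.
  have key : ∀ i < par.length, m ≤ i → 0 < i → m ≤ par.getD i 0 →
      ¬ G.Adj (σ (f i)) (σ (f (par.getD i 0))) ∧
      G.dist (σ (f i)) (σ (f (par.getD i 0))) ≤ 6 := by
    intro i hi hmi h0 hm
    have hpi := (hall i hi).2.1 h0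
    have h1 := (hall i hi).2.2 hmi
    have h2 := h1.2.2.2 h0 hm
    have h3 := (hall i hi).1
    have h4 := (hall (par.getD i 0) (by omega)).1
    rw [hσ i hi, hσ _ (by omega), hf _ h3 _ h4]
    exact ⟨h2.1, (hd 20 _ h3 _ h4 (by omega)).trans h2.2⟩
  have key2 : ∀ u ∈ S, ∀ v ∈ S, G.Adj u v →
      ¬ G.Adj (σ u) (σ v) ∧ G.dist (σ u) (σ v) ≤ 6 := by
    intro u hu v hv huv
    obtain ⟨i, hi, hmi, rfl⟩ := (hS u).1 hu
    obtain ⟨j, hj, hmj, rfl⟩ := (hS v).1 hv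
    rcases (hf i hi j hj).1 huv with ⟨hij, rfl⟩ | ⟨hij, rfl⟩
    · rw [G.adj_comm, SimpleGraph.dist_comm]
      exact key j hj hmj (by omega) hmi
    · exact key i hi hmi (by omega) hmj
  refine ⟨σ, ⟨?_, fun u hu v hv h => (key2 u hu v hv h).1, fun u hu v hv h => (key2 u hu v hv h).2,
    ?_, ?_⟩, hσ⟩
  · intro v
    rw [hS]
    constructor
    · intro h
      by_contra hcon
      refine h (hσ' v ?_) |>.elim
      rintro i hi rfl
      rcases lt_or_ge i m with him | him
      · exact h (by rw [hσ i hi, hfix i him])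
      · exact hcon ⟨i, hi, him, rfl⟩
    · rintro ⟨i, hi, hmi, rfl⟩ h
      rw [hσ i hi] at h
      exact ((hall i hi).2.2 hmi).1 (hinj _ (hall i hi).1 _ hi h)
  · intro v hv
    obtain ⟨i, hi, hmi, rfl⟩ := (hS v).1 hv
    have h1 := ((hall i hi).2.2 hmi).2.1
    rw [hσ i hi]
    exact (hd 20 _ hi _ (hall i hi).1 (by omega)).trans h1
  · intro v
    by_cases hv : ∃ i < par.length, m ≤ i ∧ f i = v
    · obtain ⟨i, hi, hmi, rfl⟩ := hv
      obtain ⟨k, hk, hki⟩ := ((hall i hi).2.2 hmi).2.2.1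
      have hit : ∀ t, (fun a => p.getD a 0)^[t] i < par.length ∧
          σ^[t] (f i) = f ((fun a => p.getD a 0)^[t] i) := by
        intro t
        induction t with
        | zero => exact ⟨hi, rfl⟩
        | succ t ih =>
          rw [Function.iterate_succ_apply', Function.iterate_succ_apply', ih.2]
          exact ⟨(hall _ ih.1).1, hσ _ ih.1⟩
      exact ⟨k, hk, by rw [(hit _).2, hki]⟩
    · refine ⟨0, by omega, ?_⟩
      by_contra h
      refine h (hσ' v ?_)
      rintro i hi rfl
      rcases lt_or_ge i m with him | him
      · exact h ((hσ i hi).trans (by rw [hfix i him]))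
      · exact hv ⟨i, hi, him, rfl⟩

theorem IsWellPlacementList.wellPlaced {V : Type*} [DecidableEq V] {G : SimpleGraph V}
    (hG : G.Connected) {par p : List ℕ} {k : ℕ} {l : List V} (h : IsWellPlacementList par p k)
    (hl : Realizes G par l) (hk : k < l.length) : WellPlaced G l.toFinset l[k] := by
  obtain ⟨h0, hx, hy⟩ := h
  obtain ⟨f, hfl, hmem, hinj, hf⟩ := hl.exists_fun (List.ne_nil_of_length_pos (by omega))
  obtain ⟨σ, hσ, hσf⟩ := h0.exists_placedOn hG hinj hf (S := l.toFinset) (by simp [hmem])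
  have hd := dist_le_treeDist hG (fun i hi => (h0.2.2.2 i hi).2.1) hf
  have hk' : k < par.length := hl.length_eq ▸ hk
  rw [← hfl k hk]
  refine ⟨σ, hσ, ?_, ?_⟩
  · rw [hσf k hk']
    exact (hd 20 _ hk' _ (h0.2.2.2 k hk').1 (by omega)).trans hx
  · intro y hyS hadj
    obtain ⟨i, hi, rfl⟩ := (hmem y).1 (List.mem_toFinset.1 hyS)
    have := hy i hi ((hf _ hk' _ hi).1 hadj)
    rw [hσf i hi]
    exact (hd 20 _ hi _ (h0.2.2.2 i hi).1 (by omega)).trans this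

theorem IsGadgetList.exists_placedOn {V : Type*} [DecidableEq V] {G : SimpleGraph V}
    (hG : G.Connected) {par p : List ℕ} {v : V} {ls : List V} (h : IsGadgetList par p)
    (hl : Realizes G par (v :: ls)) : ∃ σ : Equiv.Perm V, PlacedOn G ls.toFinset σ ∧
      ∀ y ∈ ls, G.Adj v y → G.dist v (σ y) ≤ 2 := by
  obtain ⟨h0, hy⟩ := h
  obtain ⟨f, hfl, hmem, hinj, hf⟩ := hl.exists_fun (by simp)
  have hlen := hl.length_eq
  have h0v : f 0 = v := hfl 0 (by simp)
  have h0p : 0 < par.length := by rw [← hlen]; simp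
  have hmem' : ∀ w, w ∈ ls ↔ ∃ i < par.length, 1 ≤ i ∧ f i = w := by
    intro w
    have hv := (List.nodup_cons.1 hl.nodup).1
    constructor
    · intro hw
      obtain ⟨i, hi, rfl⟩ := (hmem w).1 (by simp [hw])
      refine ⟨i, hi, Nat.one_le_iff_ne_zero.2 ?_, rfl⟩
      rintro rfl
      exact hv (h0v ▸ hw)
    · rintro ⟨i, hi, h1, rfl⟩
      rcases List.mem_cons.1 ((hmem (f i)).2 ⟨i, hi, rfl⟩) with h | h
      · have := hinj i hi 0 h0p (h.trans h0v.symm)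
        omega
      · exact h
  obtain ⟨σ, hσ, hσf⟩ := h0.exists_placedOn hG hinj hf (S := ls.toFinset) (by simp [hmem'])
  have hd := dist_le_treeDist hG (fun i hi => (h0.2.2.2 i hi).2.1) hf
  refine ⟨σ, hσ, ?_⟩
  intro y hyS hadj
  obtain ⟨i, hi, h1, rfl⟩ := (hmem' y).1 hyS
  rw [← h0v] at hadj ⊢
  have h2 : par.getD i 0 = 0 := by
    rcases (hf _ h0p _ hi).1 hadj with h | h
    · exact h.2
    · omega
  have := hy i hi (by omega) h2
  rw [hσf i hi]
  exact (hd 20 _ h0p _ (h0.2.2.2 i hi).1 (by omega)).trans this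

/-! ### Tables of explicit placements. -/

/-- The trees whose branches at the root can be packed, with a placement of these branches: they are
the trees with two branches that are paths with at most three vertices, and the path with five
vertices. -/
def gadgetPlacements : List (List ℕ × List ℕ) :=
  [([0, 0, 0], [0, 2, 1]),
   ([0, 0, 0, 2], [0, 2, 3, 1]),
   ([0, 0, 1, 0, 3], [0, 2, 3, 4, 1]),
   ([0, 0, 0, 2, 3], [0, 3, 1, 4, 2]),
   ([0, 0, 1, 0, 3, 4], [0, 2, 4, 1, 5, 3]),
   ([0, 0, 1, 2, 0, 4, 5], [0, 5, 3, 4, 2, 6, 1]),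
   ([0, 0, 1, 2, 3], [0, 2, 4, 1, 3])]

/-- Entries `(n, x, v, q, p)`: the list `p` encodes a placement, with base of index `x`, of the tree
obtained by gluing the gadget `q` to the vertex of index `v` of the star with `n` vertices whose
centre has index `0`. -/
def starPlacements : List (ℕ × ℕ × ℕ × List ℕ × List ℕ) :=
  [(1, 0, 0, [0, 0, 0, 2], [1, 2, 3, 0]),
   (1, 0, 0, [0, 0, 1, 0, 3], [2, 3, 1, 4, 0]),
   (1, 0, 0, [0, 0, 0, 2, 3], [1, 2, 4, 0, 3]),
   (1, 0, 0, [0, 0, 1, 0, 3, 4], [1, 4, 0, 5, 2, 3]),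
   (1, 0, 0, [0, 0, 1, 2, 0, 4, 5], [1, 3, 5, 0, 6, 2, 4]),
   (1, 0, 0, [0, 0, 1, 2, 3], [1, 3, 0, 4, 2]),
   (2, 0, 0, [0, 0, 0, 2], [1, 2, 3, 4, 0]),
   (2, 0, 0, [0, 0, 1, 0, 3], [1, 3, 5, 0, 2, 4]),
   (2, 0, 0, [0, 0, 0, 2, 3], [1, 4, 3, 2, 5, 0]),
   (2, 0, 0, [0, 0, 1, 0, 3, 4], [1, 2, 5, 0, 6, 3, 4]),
   (2, 0, 0, [0, 0, 1, 2, 0, 4, 5], [1, 2, 4, 6, 0, 3, 7, 5]),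
   (2, 0, 0, [0, 0, 1, 2, 3], [1, 3, 4, 0, 5, 2]),
   (2, 0, 1, [0, 0, 0, 2], [1, 4, 0, 2, 3]),
   (2, 0, 1, [0, 0, 1, 0, 3], [1, 3, 4, 0, 5, 2]),
   (2, 0, 1, [0, 0, 0, 2, 3], [1, 5, 3, 2, 0, 4]),
   (2, 0, 1, [0, 0, 1, 0, 3, 4], [1, 3, 0, 5, 6, 2, 4]),
   (2, 0, 1, [0, 0, 1, 2, 0, 4, 5], [1, 3, 5, 4, 0, 7, 2, 6]),
   (2, 0, 1, [0, 0, 1, 2, 3], [1, 3, 5, 0, 2, 4]),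
   (3, 0, 1, [0, 0, 0], [2, 3, 1, 4, 0]),
   (3, 0, 1, [0, 0, 0, 2], [2, 5, 4, 1, 0, 3]),
   (3, 0, 1, [0, 0, 1, 0, 3], [2, 3, 1, 0, 5, 6, 4]),
   (3, 0, 1, [0, 0, 0, 2, 3], [2, 3, 1, 5, 6, 0, 4]),
   (3, 0, 1, [0, 0, 1, 0, 3, 4], [2, 3, 1, 0, 5, 7, 4, 6]),
   (3, 0, 1, [0, 0, 1, 2, 0, 4, 5], [2, 3, 1, 0, 5, 6, 8, 4, 7]),
   (3, 0, 1, [0, 0, 1, 2, 3], [2, 4, 1, 6, 0, 3, 5]),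
   (4, 0, 1, [0, 0, 0], [2, 4, 1, 5, 0, 3]),
   (2, 1, 1, [0, 0, 0, 2], [1, 4, 0, 2, 3]),
   (2, 1, 1, [0, 0, 1, 0, 3], [1, 3, 4, 0, 5, 2]),
   (2, 1, 1, [0, 0, 0, 2, 3], [2, 3, 0, 5, 1, 4]),
   (2, 1, 1, [0, 0, 1, 0, 3, 4], [1, 3, 0, 5, 6, 2, 4]),
   (2, 1, 1, [0, 0, 1, 2, 0, 4, 5], [1, 3, 5, 4, 0, 7, 2, 6]),
   (2, 1, 1, [0, 0, 1, 2, 3], [1, 3, 5, 0, 2, 4]),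
   (3, 1, 1, [0, 0, 0], [2, 3, 1, 4, 0]),
   (3, 1, 1, [0, 0, 0, 2], [1, 2, 5, 4, 3, 0]),
   (3, 1, 1, [0, 0, 1, 0, 3], [1, 2, 4, 5, 0, 6, 3]),
   (3, 1, 1, [0, 0, 0, 2, 3], [1, 2, 5, 4, 3, 6, 0]),
   (3, 1, 1, [0, 0, 1, 0, 3, 4], [1, 2, 4, 5, 0, 7, 3, 6]),
   (3, 1, 1, [0, 0, 1, 2, 0, 4, 5], [1, 2, 4, 5, 0, 6, 8, 3, 7]),
   (3, 1, 1, [0, 0, 1, 2, 3], [1, 2, 4, 5, 0, 6, 3]),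
   (4, 1, 1, [0, 0, 0], [2, 4, 1, 5, 0, 3]),
   (2, 1, 0, [0, 0, 0, 2], [1, 2, 3, 4, 0]),
   (2, 1, 0, [0, 0, 1, 0, 3], [2, 4, 5, 0, 1, 3]),
   (2, 1, 0, [0, 0, 0, 2, 3], [2, 3, 4, 1, 5, 0]),
   (2, 1, 0, [0, 0, 1, 0, 3, 4], [1, 2, 5, 0, 6, 3, 4]),
   (2, 1, 0, [0, 0, 1, 2, 0, 4, 5], [1, 2, 4, 6, 0, 3, 7, 5]),
   (2, 1, 0, [0, 0, 1, 2, 3], [3, 0, 5, 1, 2, 4]),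
   (3, 1, 0, [0, 0, 0, 2], [1, 4, 3, 2, 5, 0]),
   (3, 1, 0, [0, 0, 1, 0, 3], [1, 2, 4, 6, 0, 3, 5]),
   (3, 1, 0, [0, 0, 0, 2, 3], [1, 2, 5, 4, 3, 6, 0]),
   (3, 1, 0, [0, 0, 1, 0, 3, 4], [1, 2, 3, 7, 5, 6, 4, 0]),
   (3, 1, 0, [0, 0, 1, 2, 0, 4, 5], [1, 2, 3, 5, 7, 0, 4, 8, 6]),
   (3, 1, 0, [0, 0, 1, 2, 3], [1, 2, 4, 5, 0, 6, 3]),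
   (3, 1, 2, [0, 0, 0], [1, 2, 3, 4, 0]),
   (3, 1, 2, [0, 0, 0, 2], [4, 0, 3, 5, 1, 2]),
   (3, 1, 2, [0, 0, 1, 0, 3], [1, 2, 3, 0, 5, 6, 4]),
   (3, 1, 2, [0, 0, 0, 2, 3], [1, 2, 3, 5, 6, 0, 4]),
   (3, 1, 2, [0, 0, 1, 0, 3, 4], [1, 2, 3, 0, 5, 7, 4, 6]),
   (3, 1, 2, [0, 0, 1, 2, 0, 4, 5], [1, 2, 3, 0, 5, 6, 8, 4, 7]),
   (3, 1, 2, [0, 0, 1, 2, 3], [1, 2, 4, 6, 0, 3, 5]),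
   (4, 1, 2, [0, 0, 0], [1, 2, 4, 5, 0, 3]),
   (4, 1, 2, [0, 0, 0, 2], [1, 2, 3, 6, 5, 4, 0]),
   (4, 1, 2, [0, 0, 1, 0, 3], [1, 2, 3, 5, 6, 0, 7, 4]),
   (4, 1, 2, [0, 0, 0, 2, 3], [1, 2, 3, 6, 5, 7, 0, 4]),
   (4, 1, 2, [0, 0, 1, 0, 3, 4], [1, 2, 3, 5, 6, 0, 8, 4, 7]),
   (4, 1, 2, [0, 0, 1, 2, 0, 4, 5], [1, 2, 3, 5, 6, 0, 7, 9, 4, 8]),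
   (4, 1, 2, [0, 0, 1, 2, 3], [1, 2, 3, 5, 6, 0, 7, 4])]

/-- The trees whose branches at the root can be packed. -/
def gadgets : List (List ℕ) := gadgetPlacements.map Prod.fst

theorem exists_isGadgetList {q : List ℕ} (hq : q ∈ gadgets) : ∃ p, IsGadgetList q p := by
  have h : ∀ r ∈ gadgetPlacements, IsGadgetList r.1 r.2 := by decide +kernel
  obtain ⟨r, hr, rfl⟩ := List.mem_map.1 hq
  exact ⟨r.2, h r hr⟩

/-- Gluing the gadget `q` to the vertex of index `v` of the star with `n` vertices and centre of
index `0` gives a tree that has a placement with base of index `x`. -/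
def IsGoodStar (n x v : ℕ) (q : List ℕ) : Prop :=
  ∃ p, IsWellPlacementList (glueParents (List.replicate n 0) q v) p x

theorem isGoodStar_of_mem {n x v : ℕ} {q : List ℕ}
    (h : (n, x, v, q) ∈ starPlacements.map fun r => (r.1, r.2.1, r.2.2.1, r.2.2.2.1)) :
    IsGoodStar n x v q := by
  have hall : ∀ r ∈ starPlacements, IsWellPlacementList
      (glueParents (List.replicate r.1 0) r.2.2.2.1 r.2.2.1) r.2.2.2.2 r.2.1 := by decide +kernel
  obtain ⟨r, hr, he⟩ := List.mem_map.1 h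
  simp only [Prod.mk.injEq] at he
  obtain ⟨rfl, rfl, rfl, rfl⟩ := he
  exact ⟨_, hall r hr⟩

theorem isGoodStar_of_ne {q : List ℕ} (hq : q ∈ gadgets) (hne : q ≠ [0, 0, 0]) :
    ∀ n x v, (n, x, v) ∈ [(1, 0, 0), (2, 0, 0), (2, 0, 1), (3, 0, 1), (2, 1, 1), (3, 1, 1),
      (2, 1, 0), (3, 1, 0), (3, 1, 2), (4, 1, 2)] → IsGoodStar n x v q := by
  have hall : ∀ q ∈ gadgets, q ≠ [0, 0, 0] → ∀ t ∈ [(1, 0, 0), (2, 0, 0), (2, 0, 1), (3, 0, 1),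
      (2, 1, 1), (3, 1, 1), (2, 1, 0), (3, 1, 0), (3, 1, 2), (4, 1, 2)],
      (t.1, t.2.1, t.2.2, q) ∈ starPlacements.map fun r => (r.1, r.2.1, r.2.2.1, r.2.2.2.1) := by
    decide +kernel
  exact fun n x v h => isGoodStar_of_mem (hall q hq hne (n, x, v) h)

/-- Two leaves at the centre of a star, or at an end of a single edge, again give a star. So the
entries for this gadget have at least three star vertices and attach it to a leaf. -/
theorem isGoodStar_twins : ∀ n x v, (n, x, v) ∈ [(3, 0, 1), (4, 0, 1), (3, 1, 1), (4, 1, 1),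
    (3, 1, 2), (4, 1, 2)] → IsGoodStar n x v [0, 0, 0] := by
  have hall : ∀ t ∈ [(3, 0, 1), (4, 0, 1), (3, 1, 1), (4, 1, 1), (3, 1, 2), (4, 1, 2)],
      (t.1, t.2.1, t.2.2, [0, 0, 0]) ∈
        starPlacements.map fun r => (r.1, r.2.1, r.2.2.1, r.2.2.2.1) := by
    decide +kernel
  exact fun n x v h => isGoodStar_of_mem (hall (n, x, v) h)

/-! ### Attaching a gadget to a placed part. -/

/-- The set `S` arises from `R` by attaching the branches of a gadget to a vertex of `R`. -/
def Step {V : Type*} [DecidableEq V] (G : SimpleGraph V) (R S : Finset V) : Prop :=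
  ∃ q ∈ gadgets, ∃ v ∈ R, ∃ ls : List V, Realizes G q (v :: ls) ∧
    (∀ r ∈ R, ∀ d ∈ ls, r ≠ d ∧ (G.Adj r d → r = v)) ∧ S = R ∪ ls.toFinset

theorem PlacedOn.apply_mem {V : Type*} {G : SimpleGraph V} {S : Finset V} {σ : Equiv.Perm V}
    (h : PlacedOn G S σ) {v : V} (hv : v ∈ S) : σ v ∈ S :=
  (h.ne_iff _).1 fun he => (h.ne_iff v).2 hv (σ.injective he)

theorem PlacedOn.apply_eq {V : Type*} {G : SimpleGraph V} {S : Finset V} {σ : Equiv.Perm V}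
    (h : PlacedOn G S σ) {v : V} (hv : v ∉ S) : σ v = v :=
  not_not.1 fun hn => hv ((h.ne_iff v).1 hn)

/-- The supports of `σ` and `τ` are `R` and the gadget, so only joining edges need an argument. A
new neighbour `d` of `x` is moved by at most 1 + 2 = 3, through `x`. -/
theorem WellPlaced.step {V : Type*} [DecidableEq V] {G : SimpleGraph V} (hG : G.Connected)
    {R S : Finset V} {x : V} (hx : x ∈ R) (h : WellPlaced G R x) (hs : Step G R S) :
    WellPlaced G S x := by
  obtain ⟨σ, hσ, hσx, hσy⟩ := h
  obtain ⟨q, hq, v, hv, ls, hl, hc, rfl⟩ := hs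
  obtain ⟨p, hp⟩ := exists_isGadgetList hq
  obtain ⟨τ, hτ, hτv⟩ := hp.exists_placedOn hG hl
  have hdis : ∀ d ∈ ls.toFinset, d ∉ R := fun d hd hr => (hc d hr d (List.mem_toFinset.1 hd)).1 rfl
  have hR : ∀ u ∈ R, (σ * τ) u = σ u := fun u hu => by
    rw [Equiv.Perm.mul_apply, hτ.apply_eq fun h => hdis u h hu]
  have hD : ∀ d ∈ ls.toFinset, (σ * τ) d = τ d := fun d hd => by
    rw [Equiv.Perm.mul_apply, hσ.apply_eq (hdis _ (hτ.apply_mem hd))]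
  have cross : ∀ r ∈ R, ∀ d ∈ ls.toFinset, G.Adj r d →
      ¬ G.Adj ((σ * τ) r) ((σ * τ) d) ∧ G.dist ((σ * τ) r) ((σ * τ) d) ≤ 6 := by
    intro r hr d hd hadj
    obtain rfl := (hc r hr d (List.mem_toFinset.1 hd)).2 hadj
    rw [hR r hr, hD d hd]
    constructor
    · intro had
      exact (hσ.ne_iff r).2 hr
        ((hc _ (hσ.apply_mem hr) _ (List.mem_toFinset.1 (hτ.apply_mem hd))).2 had)
    · have h1 := hσ.dist_le_four r hr
      rw [SimpleGraph.dist_comm] at h1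
      have h2 := hτv d (List.mem_toFinset.1 hd) hadj
      exact (hG.dist_triangle (v := r)).trans (by omega)
  have key : ∀ u ∈ R ∪ ls.toFinset, ∀ w ∈ R ∪ ls.toFinset, G.Adj u w →
      ¬ G.Adj ((σ * τ) u) ((σ * τ) w) ∧ G.dist ((σ * τ) u) ((σ * τ) w) ≤ 6 := by
    intro u hu w hw huw
    rcases Finset.mem_union.1 hu with hu | hu <;> rcases Finset.mem_union.1 hw with hw | hw
    · rw [hR u hu, hR w hw]
      exact ⟨hσ.not_adj u hu w hw huw, hσ.dist_le_six u hu w hw huw⟩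
    · exact cross u hu w hw huw
    · rw [G.adj_comm, SimpleGraph.dist_comm]
      exact cross w hw u hu huw.symm
    · rw [hD u hu, hD w hw]
      exact ⟨hτ.not_adj u hu w hw huw, hτ.dist_le_six u hu w hw huw⟩
  refine ⟨σ * τ, ⟨?_, fun u hu w hw h => (key u hu w hw h).1, fun u hu w hw h => (key u hu w hw h).2,
    ?_, ?_⟩, ?_, ?_⟩
  · intro u
    by_cases hu : u ∈ R
    · rw [hR u hu, hσ.ne_iff]; simp [hu]
    · by_cases hd : u ∈ ls.toFinset
      · rw [hD u hd, hτ.ne_iff]; simp [hd]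
      · rw [Equiv.Perm.mul_apply, hτ.apply_eq hd, hσ.apply_eq hu, Finset.mem_union]
        simp only [hu, hd, or_self, ne_eq, not_true_eq_false]
  · intro u hu
    rcases Finset.mem_union.1 hu with hu | hu
    · rw [hR u hu]; exact hσ.dist_le_four u hu
    · rw [hD u hu]; exact hτ.dist_le_four u hu
  · intro u
    by_cases hu : u ∈ R
    · obtain ⟨k, hk, hku⟩ := hσ.period u
      have : ∀ t, σ^[t] u ∈ R ∧ (σ * τ)^[t] u = σ^[t] u := by
        intro t
        induction t with
        | zero => exact ⟨hu, rfl⟩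
        | succ t ih =>
          rw [Function.iterate_succ_apply', Function.iterate_succ_apply', ih.2, hR _ ih.1]
          exact ⟨hσ.apply_mem ih.1, rfl⟩
      exact ⟨k, hk, (this _).2.trans hku⟩
    · by_cases hd : u ∈ ls.toFinset
      · obtain ⟨k, hk, hku⟩ := hτ.period u
        have : ∀ t, τ^[t] u ∈ ls.toFinset ∧ (σ * τ)^[t] u = τ^[t] u := by
          intro t
          induction t with
          | zero => exact ⟨hd, rfl⟩
          | succ t ih =>
            rw [Function.iterate_succ_apply', Function.iterate_succ_apply', ih.2, hD _ ih.1]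
            exact ⟨hτ.apply_mem ih.1, rfl⟩
        exact ⟨k, hk, (this _).2.trans hku⟩
      · refine ⟨0, by omega, ?_⟩
        rw [zero_add, Function.iterate_one, Equiv.Perm.mul_apply, hτ.apply_eq hd, hσ.apply_eq hu]
  · rw [hR x hx]; exact hσx
  · intro y hy hxy
    rcases Finset.mem_union.1 hy with hy | hy
    · rw [hR y hy]; exact hσy y hy hxy
    · obtain rfl := (hc x hx y (List.mem_toFinset.1 hy)).2 hxy
      rw [hD y hy]
      have h1 := hτv y (List.mem_toFinset.1 hy) hxy
      have h2 := SimpleGraph.dist_eq_one_iff_adj.2 hxy.symm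
      exact (hG.dist_triangle (v := x)).trans (by omega)

/-! ### Stars with a gadget attached. -/

theorem realizes_star {V : Type*} {G : SimpleGraph V} {c : V} {t : List V}
    (hnd : (c :: t).Nodup) (h1 : ∀ a ∈ t, G.Adj c a) (h2 : ∀ a ∈ t, ∀ b ∈ t, ¬ G.Adj a b) :
    Realizes G (List.replicate (t.length + 1) 0) (c :: t) := by
  refine ⟨hnd, by simp, fun i j hi hj hij => ?_⟩
  obtain ⟨j, rfl⟩ := Nat.exists_eq_add_of_le' (show 1 ≤ j by omega)
  have h3 : (List.replicate (t.length + 1) 0).getD (j + 1) 0 = 0 := by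
    rw [List.getD_eq_getElem _ _ (by simpa using hj), List.getElem_replicate]
  rw [h3]
  rcases i with _ | i
  · simpa using h1 _ (List.getElem_mem _)
  · simpa using h2 _ (List.getElem_mem _) _ (List.getElem_mem _)

theorem WellPlaced.union_twins {V : Type*} [DecidableEq V] {G : SimpleGraph V} (hG : G.Connected)
    {x c : V} (n : ℕ) : ∀ {R L : Finset V}, x ∈ R → c ∈ R → WellPlaced G R x → L.card = 2 * n →
    Disjoint R L → (∀ a ∈ L, G.Adj c a) → (∀ r ∈ R ∪ L, ∀ a ∈ L, G.Adj r a → r = c) →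
    WellPlaced G (R ∪ L) x := by
  induction n with
  | zero =>
    intro R L hx hc h hL _ _ _
    rw [Finset.card_eq_zero.1 hL, Finset.union_empty]
    exact h
  | succ n ih =>
    intro R L hx hc h hL hdis h1 h2
    obtain ⟨a, ha, b, hb, hab⟩ := Finset.one_lt_card.1 (by omega : 1 < L.card)
    have hstep : Step G R (R ∪ {a, b}) := by
      have hca := h1 a ha
      have hcb := h1 b hb
      have haL : ∀ w ∈ L, w ∉ R := fun w hw hr => Finset.disjoint_left.1 hdis hr hw
      refine ⟨[0, 0, 0], by decide, c, hc, [a, b], ?_, ?_, by simp⟩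
      · refine realizes_star (t := [a, b]) (by simp [hab, hca.ne, hcb.ne]) (by simp [hca, hcb]) ?_
        intro u hu w hw huw
        have hm : ∀ w ∈ [a, b], w ∈ L := by simp [ha, hb]
        have := h2 u (Finset.mem_union_right _ (hm u hu)) w (hm w hw) huw
        exact (h1 u (hm u hu)).ne this.symm
      · have hm : ∀ w ∈ [a, b], w ∈ L := by simp [ha, hb]
        exact fun r hr d hd => ⟨fun he => haL d (hm d hd) (he ▸ hr),
          h2 r (Finset.mem_union_left _ hr) d (hm d hd)⟩
    have hsub : {a, b} ⊆ L := by
      intro w hw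
      rcases Finset.mem_insert.1 hw with rfl | hw
      · exact ha
      · exact Finset.mem_singleton.1 hw ▸ hb
    have hcard : (L \ {a, b}).card = 2 * n := by
      rw [Finset.card_sdiff_of_subset hsub, Finset.card_pair hab]
      omega
    have hun : (R ∪ {a, b}) ∪ (L \ {a, b}) = R ∪ L := by
      rw [Finset.union_assoc, Finset.union_sdiff_of_subset hsub]
    have := ih (R := R ∪ {a, b}) (L := L \ {a, b}) (Finset.mem_union_left _ hx)
      (Finset.mem_union_left _ hc) (h.step hG hx hstep) hcard
      (Finset.disjoint_union_left.2 ⟨hdis.mono_right Finset.sdiff_subset, Finset.disjoint_sdiff⟩)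
      (fun w hw => h1 w (Finset.sdiff_subset hw))
      (fun r hr w hw => h2 r (hun ▸ hr) w (Finset.sdiff_subset hw))
    rwa [hun] at this

/-- The set `S` induces in `G` a star with centre `c`. -/
def StarOn {V : Type*} (G : SimpleGraph V) (S : Finset V) (c : V) : Prop :=
  c ∈ S ∧ ∀ u ∈ S, ∀ v ∈ S, (G.Adj u v ↔ u ≠ v ∧ (u = c ∨ v = c))

/-- The centre and the leaves in `t` form a small star covered by the table once the gadget is glued
on. The remaining leaves, even in number, are then restored in pairs at the centre. -/
theorem StarOn.wellPlaced_of_even {V : Type*} [DecidableEq V] {G : SimpleGraph V}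
    (hG : G.Connected) {S : Finset V} {c : V} (hS : StarOn G S c) {q : List ℕ} {t ls : List V}
    {i j : ℕ} (hnd : (c :: t).Nodup) (ht : ∀ a ∈ t, a ∈ S) (hi : i < (c :: t).length)
    (hj : j < (c :: t).length) (hq : Realizes G q ((c :: t)[j] :: ls))
    (hc : ∀ r ∈ S, ∀ d ∈ ls, r ≠ d ∧ (G.Adj r d → r = (c :: t)[j]))
    (hg : IsGoodStar (t.length + 1) i j q) (hev : Even (S \ (c :: t).toFinset).card) :
    WellPlaced G (S ∪ ls.toFinset) (c :: t)[i] := by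
  obtain ⟨p, hp⟩ := hg
  have htS : ∀ a ∈ c :: t, a ∈ S := by
    intro a ha
    rcases List.mem_cons.1 ha with rfl | ha
    · exact hS.1
    · exact ht a ha
  have hct : ∀ a ∈ t, c ≠ a := fun a ha he => (List.nodup_cons.1 hnd).1 (he ▸ ha)
  have hr := realizes_star (G := G) hnd
    (fun a ha => (hS.2 c hS.1 a (ht a ha)).2 ⟨hct a ha, Or.inl rfl⟩)
    (fun a ha b hb hab => by
      rcases ((hS.2 a (ht a ha) b (ht b hb)).1 hab).2 with h | h
      · exact hct a ha h.symm
      · exact hct b hb h.symm)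
  have hw := hp.wellPlaced hG (hr.glue hq hj rfl fun r hr d hd => hc r (htS r hr) d hd)
    (by rw [List.length_append]; omega)
  rw [List.getElem_append_left hi, List.toFinset_append] at hw
  obtain ⟨n, hn⟩ := hev
  have hsub : (c :: t).toFinset ⊆ S := fun a ha => htS a (List.mem_toFinset.1 ha)
  have hLS : ∀ a ∈ S \ (c :: t).toFinset, a ∈ S ∧ c ≠ a := fun a ha =>
    ⟨(Finset.mem_sdiff.1 ha).1, fun he => (Finset.mem_sdiff.1 ha).2 (by simp [← he])⟩
  have := hw.union_twins hG n (c := c) (L := S \ (c :: t).toFinset)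
    (Finset.mem_union_left _ (List.mem_toFinset.2 (List.getElem_mem _)))
    (Finset.mem_union_left _ (by simp)) (by omega)
    (Finset.disjoint_union_left.2 ⟨Finset.disjoint_sdiff, Finset.disjoint_left.2 fun a ha ha' =>
      (hc a (hLS a ha').1 a (List.mem_toFinset.1 ha)).1 rfl⟩)
    (fun a ha => (hS.2 c hS.1 a (hLS a ha).1).2 ⟨(hLS a ha).2, Or.inl rfl⟩)
    (fun r hr a ha hra => by
      have haS := (hLS a ha).1
      have hin : r ∈ S → r = c := fun h =>
        (((hS.2 r h a haS).1 hra).2).resolve_right fun he => (hLS a ha).2 he.symm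
      rcases Finset.mem_union.1 hr with hr | hr
      · rcases Finset.mem_union.1 hr with hr | hr
        · exact hin (hsub hr)
        · have := (hc a haS r (List.mem_toFinset.1 hr)).2 hra.symm
          exact ((Finset.mem_sdiff.1 ha).2
            (List.mem_toFinset.2 (this ▸ List.getElem_mem _))).elim
      · exact hin (hLS r hr).1)
  rwa [Finset.union_right_comm, Finset.union_sdiff_of_subset hsub] at this

theorem StarOn.wellPlaced {V : Type*} [DecidableEq V] {G : SimpleGraph V}
    (hG : G.Connected) {S : Finset V} {c : V} (hS : StarOn G S c) {q : List ℕ} {t ls : List V}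
    {i j : ℕ} (hnd : (c :: t).Nodup) (ht : ∀ a ∈ t, a ∈ S) (hi : i < (c :: t).length)
    (hj : j < (c :: t).length) (hq : Realizes G q ((c :: t)[j] :: ls))
    (hc : ∀ r ∈ S, ∀ d ∈ ls, r ≠ d ∧ (G.Adj r d → r = (c :: t)[j]))
    (hg : IsGoodStar (t.length + 1) i j q) (hg' : IsGoodStar (t.length + 1 + 1) i j q) :
    WellPlaced G (S ∪ ls.toFinset) (c :: t)[i] := by
  rcases Nat.even_or_odd (S \ (c :: t).toFinset).card with hev | hodd
  · exact hS.wellPlaced_of_even hG hnd ht hi hj hq hc hg hev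
  -- For an odd surplus, one more leaf `e` is moved into the small star, which is why two
  -- consecutive sizes are tabulated.
  · obtain ⟨e, he⟩ := Finset.card_pos.1 hodd.pos
    have heS := (Finset.mem_sdiff.1 he).1
    have het : e ∉ c :: t := fun h => (Finset.mem_sdiff.1 he).2 (List.mem_toFinset.2 h)
    have hget : ∀ k (hk : k < (c :: t).length), (c :: (t ++ [e]))[k]'(by simp at hk ⊢; omega) =
        (c :: t)[k] := fun k hk => by
      simp only [← List.cons_append]
      exact List.getElem_append_left hk
    rw [← hget i hi]
    rw [← hget j hj] at hq hc
    refine hS.wellPlaced_of_even hG (t := t ++ [e]) ?_ ?_ _ _ hq hc (by simpa using hg') ?_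
    · rw [← List.cons_append]
      refine List.nodup_append.2 ⟨hnd, by simp, ?_⟩
      rintro a ha b hb rfl
      exact het (List.mem_singleton.1 hb ▸ ha)
    · intro a ha
      rcases List.mem_append.1 ha with ha | ha
      · exact ht a ha
      · exact List.mem_singleton.1 ha ▸ heS
    · have : S \ (c :: (t ++ [e])).toFinset = (S \ (c :: t).toFinset).erase e := by
        ext a
        simp only [Finset.mem_sdiff, List.mem_toFinset, Finset.mem_erase, List.mem_cons,
          List.mem_append, List.mem_nil_iff, or_false]
        tauto
      rw [this, Finset.card_erase_of_mem he]
      obtain ⟨k, hk⟩ := hodd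
      exact ⟨k, by omega⟩

theorem StarOn.union_twins {V : Type*} [DecidableEq V] {G : SimpleGraph V} {S : Finset V} {c : V}
    {ls : List V} (hS : StarOn G S c) (hl : Realizes G [0, 0, 0] (c :: ls))
    (hc : ∀ r ∈ S, ∀ d ∈ ls, r ≠ d ∧ (G.Adj r d → r = c)) : StarOn G (S ∪ ls.toFinset) c := by
  have hlen : ls.length = 2 := by simpa using hl.length_eq
  obtain ⟨a, b, rfl⟩ := List.length_eq_two.1 hlen
  have hca : G.Adj c a := by simpa using hl.adj_iff 0 1 (by simp) (by simp) (by omega)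
  have hcb : G.Adj c b := by simpa using hl.adj_iff 0 2 (by simp) (by simp) (by omega)
  have hab : ¬ G.Adj a b := by simpa using hl.adj_iff 1 2 (by simp) (by simp) (by omega)
  have hadj : ∀ d ∈ [a, b], G.Adj c d := by simp [hca, hcb]
  have hnadj : ∀ d ∈ [a, b], ∀ e ∈ [a, b], ¬ G.Adj d e := by
    simp [hab, mt SimpleGraph.Adj.symm hab]
  have hcr : ∀ r ∈ S, ∀ d ∈ [a, b], (G.Adj r d ↔ r ≠ d ∧ (r = c ∨ d = c)) := by
    intro r hr d hd
    have h1 := hc r hr d hd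
    have h2 := hadj d hd
    constructor
    · exact fun h => ⟨h1.1, Or.inl (h1.2 h)⟩
    · rintro ⟨-, rfl | rfl⟩
      · exact h2
      · exact (h2.ne rfl).elim
  refine ⟨Finset.mem_union_left _ hS.1, fun u hu v hv => ?_⟩
  rw [Finset.mem_union, List.mem_toFinset] at hu hv
  rcases hu with hu | hu <;> rcases hv with hv | hv
  · exact hS.2 u hu v hv
  · exact hcr u hu v hv
  · rw [G.adj_comm, hcr v hv u hu, ne_comm, or_comm]
  · refine iff_of_false (hnadj u hu v hv) ?_
    rintro ⟨-, rfl | rfl⟩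
    · exact (hadj _ hu).ne rfl
    · exact (hadj _ hv).ne rfl

/-- Apart from the two cases where twin leaves yield a star again, the table decides according to
which of the base `x`, the attaching vertex `v` and the centre `c` coincide. -/
theorem StarOn.step {V : Type*} [DecidableEq V] {G : SimpleGraph V} (hG : G.Connected)
    {S S' : Finset V} {c x : V} (hS : StarOn G S c) (hx : x ∈ S) (hs : Step G S S') :
    (∃ c', StarOn G S' c') ∨ WellPlaced G S' x := by
  obtain ⟨q, hq, v, hv, ls, hl, hc, rfl⟩ := hs
  have hthree : x ≠ c → v ≠ c → x ≠ v → IsGoodStar 3 1 2 q → IsGoodStar 4 1 2 q →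
      WellPlaced G (S ∪ ls.toFinset) x := fun hxc hvc hxv h3 h4 =>
    hS.wellPlaced hG (t := [x, v]) (i := 1) (j := 2) (by simp [hxc.symm, hvc.symm, hxv])
      (by simp [hx, hv]) (by simp) (by simp) hl hc h3 h4
  by_cases hq0 : q = [0, 0, 0]
  · subst hq0
    by_cases hvc : v = c
    · subst hvc
      exact Or.inl ⟨v, hS.union_twins hl hc⟩
    · by_cases hxv : x ≠ v ∧ x ≠ c
      · exact Or.inr (hthree hxv.2 hvc hxv.1 (isGoodStar_twins 3 1 2 (by decide))
          (isGoodStar_twins 4 1 2 (by decide)))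
      · by_cases he : ∃ e ∈ S, e ≠ c ∧ e ≠ v
        · obtain ⟨e, heS, hec, hev⟩ := he
          have hnd : [c, v, e].Nodup := by simp [Ne.symm hvc, hec.symm, hev.symm]
          right
          by_cases hxc : x = c
          · subst hxc
            exact hS.wellPlaced hG (t := [v, e]) (i := 0) (j := 1) hnd (by simp [hv, heS])
              (by simp) (by simp) hl hc (isGoodStar_twins 3 0 1 (by decide))
              (isGoodStar_twins 4 0 1 (by decide))
          · have hxv : x = v := by tauto
            subst hxv
            exact hS.wellPlaced hG (t := [x, e]) (i := 1) (j := 1) hnd (by simp [hv, heS])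
              (by simp) (by simp) hl hc (isGoodStar_twins 3 1 1 (by decide))
              (isGoodStar_twins 4 1 1 (by decide))
        -- Here the star is the single edge `cv`, so `v` may equally be taken as its centre.
        · refine Or.inl ⟨v, StarOn.union_twins ⟨hv, fun u hu w hw => ?_⟩ hl hc⟩
          rw [hS.2 u hu w hw]
          have hu' : u = c ∨ u = v := by
            by_contra hn
            exact he ⟨u, hu, by tauto⟩
          have hw' : w = c ∨ w = v := by
            by_contra hn
            exact he ⟨w, hw, by tauto⟩
          rcases hu' with rfl | rfl <;> rcases hw' with rfl | rfl <;> simp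
  · right
    have hgood := isGoodStar_of_ne hq hq0
    by_cases hvc : v = c
    · subst hvc
      by_cases hxv : x = v
      · subst hxv
        exact hS.wellPlaced hG (t := []) (i := 0) (j := 0) (by simp) (by simp) (by simp) (by simp)
          hl hc (hgood 1 0 0 (by decide)) (hgood 2 0 0 (by decide))
      · exact hS.wellPlaced hG (t := [x]) (i := 1) (j := 0) (by simp [Ne.symm hxv]) (by simp [hx])
          (by simp) (by simp) hl hc (hgood 2 1 0 (by decide)) (hgood 3 1 0 (by decide))
    · by_cases hxc : x = c
      · subst hxc
        exact hS.wellPlaced hG (t := [v]) (i := 0) (j := 1) (by simp [Ne.symm hvc]) (by simp [hv])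
          (by simp) (by simp) hl hc (hgood 2 0 1 (by decide)) (hgood 3 0 1 (by decide))
      · by_cases hxv : x = v
        · subst hxv
          exact hS.wellPlaced hG (t := [x]) (i := 1) (j := 1) (by simp [Ne.symm hvc]) (by simp [hv])
            (by simp) (by simp) hl hc (hgood 2 1 1 (by decide)) (hgood 3 1 1 (by decide))
        · exact hthree hxc hvc hxv (hgood _ _ _ (by decide)) (hgood _ _ _ (by decide))

/-! ### Recursive structure of rooted trees. -/

/-- The set `S` induces in `G` a tree, rooted at `x`. -/
inductive Rooted {V : Type*} [DecidableEq V] (G : SimpleGraph V) : Finset V → V → Prop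
  | single (x : V) : Rooted G {x} x
  | join {A B : Finset V} {x y : V} (hA : Rooted G A x) (hB : Rooted G B y)
      (hdis : Disjoint A B) (hxy : G.Adj x y)
      (hc : ∀ a ∈ A, ∀ b ∈ B, G.Adj a b → a = x ∧ b = y) : Rooted G (A ∪ B) x

theorem Rooted.root_mem {V : Type*} [DecidableEq V] {G : SimpleGraph V} {S : Finset V} {x : V}
    (h : Rooted G S x) : x ∈ S := by
  induction h with
  | single x => simp
  | join _ _ _ _ _ ih _ => exact Finset.mem_union_left _ ih

theorem Rooted.congr {V : Type*} [DecidableEq V] {G H : SimpleGraph V} {S : Finset V} {x : V}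
    (h : Rooted G S x) (hGH : ∀ a ∈ S, ∀ b ∈ S, (G.Adj a b ↔ H.Adj a b)) : Rooted H S x := by
  induction h with
  | single x => exact Rooted.single x
  | @join A B x y hA hB hdis hxy hc ihA ihB =>
    have hl : ∀ a ∈ A, a ∈ A ∪ B := fun a ha => Finset.mem_union_left _ ha
    have hr : ∀ b ∈ B, b ∈ A ∪ B := fun b hb => Finset.mem_union_right _ hb
    refine Rooted.join (ihA fun a ha b hb => hGH a (hl a ha) b (hl b hb))
      (ihB fun a ha b hb => hGH a (hr a ha) b (hr b hb)) hdis
      ((hGH x (hl x hA.root_mem) y (hr y hB.root_mem)).1 hxy) ?_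
    exact fun a ha b hb hab => hc a ha b hb ((hGH a (hl a ha) b (hr b hb)).2 hab)

open Classical in
-- Any edge `xy` at `x` is a bridge. Deleting it splits the component of `x` into those of `x` and
-- `y`, to which induction on the subgraph order applies. `Rooted.congr` brings the two parts back
-- to `G`, as the deletion changes no adjacency inside either.
theorem rooted_component {V : Type*} [Fintype V] (G : SimpleGraph V)
    (hG : G.IsAcyclic) (x : V) : Rooted G (Finset.univ.filter (G.Reachable x)) x := by
  induction G using WellFoundedLT.induction generalizing x with
  | ind G ih =>
  by_cases hx : ∃ y, G.Adj x y
  · obtain ⟨y, hxy⟩ := hx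
    have hle : G.deleteEdges {s(x, y)} ≤ G := SimpleGraph.deleteEdges_le _
    have hbr : ¬ (G.deleteEdges {s(x, y)}).Reachable x y := by
      have := SimpleGraph.isAcyclic_iff_forall_isBridge.1 hG
        (e := s(x, y)) ((SimpleGraph.mem_edgeSet G).2 hxy)
      exact (SimpleGraph.isBridge_iff).1 this
    have hadj : ∀ a b, G.Adj a b →
        (G.deleteEdges {s(x, y)}).Adj a b ∨ (a = x ∧ b = y) ∨ (a = y ∧ b = x) := by
      intro a b hab
      rw [SimpleGraph.deleteEdges_adj, Set.mem_singleton_iff, Sym2.eq_iff]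
      tauto
    have hlt : G.deleteEdges {s(x, y)} < G := lt_of_le_of_ne hle fun he => hbr (by rw [he]; exact hxy.reachable)
    generalize G.deleteEdges {s(x, y)} = H at *
    have hH := hG.anti hle
    have hreach : ∀ v, G.Reachable x v ↔ H.Reachable x v ∨ H.Reachable y v := by
      intro v
      constructor
      · intro h
        rw [SimpleGraph.reachable_iff_reflTransGen] at h
        induction h with
        | refl => exact Or.inl (SimpleGraph.Reachable.refl x)
        | tail _ hbc ih =>
          rcases hadj _ _ hbc with h | ⟨-, rfl⟩ | ⟨-, rfl⟩
          · exact ih.imp (fun h' => h'.trans h.reachable) (fun h' => h'.trans h.reachable)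
          · exact Or.inr (SimpleGraph.Reachable.refl _)
          · exact Or.inl (SimpleGraph.Reachable.refl _)
      · rintro (h | h)
        · exact h.mono hle
        · exact hxy.reachable.trans (h.mono hle)
    have hun : Finset.univ.filter (G.Reachable x) =
        Finset.univ.filter (H.Reachable x) ∪ Finset.univ.filter (H.Reachable y) := by
      ext v
      simp [hreach]
    rw [hun]
    have hsame : ∀ z a b, (z = x ∨ z = y) → H.Reachable z a → H.Reachable z b →
        (H.Adj a b ↔ G.Adj a b) := by
      intro z a b hz ha hb
      refine ⟨fun h => hle h, fun h => ?_⟩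
      rcases hadj a b h with h | ⟨rfl, rfl⟩ | ⟨rfl, rfl⟩
      · exact h
      · exact (hbr (ha.symm.trans hb)).elim
      · exact (hbr (hb.symm.trans ha)).elim
    refine Rooted.join ((ih H hlt hH x).congr fun a ha b hb => ?_)
      ((ih H hlt hH y).congr fun a ha b hb => ?_) ?_ hxy ?_
    · exact hsame x a b (Or.inl rfl) (by simpa using ha) (by simpa using hb)
    · exact hsame y a b (Or.inr rfl) (by simpa using ha) (by simpa using hb)
    · refine Finset.disjoint_left.2 fun a ha hb => hbr ?_
      simp only [Finset.mem_filter, Finset.mem_univ, true_and] at ha hb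
      exact ha.trans hb.symm
    · intro a ha b hb hab
      simp only [Finset.mem_filter, Finset.mem_univ, true_and] at ha hb
      rcases hadj a b hab with h | h | ⟨rfl, rfl⟩
      · exact (hbr ((ha.trans h.reachable).trans hb.symm)).elim
      · exact h
      · exact (hbr ha).elim
  · have : Finset.univ.filter (G.Reachable x) = {x} := by
      ext v
      simp only [Finset.mem_filter, Finset.mem_univ, true_and, Finset.mem_singleton]
      constructor
      · intro h
        rw [SimpleGraph.reachable_iff_reflTransGen] at h
        rcases Relation.ReflTransGen.cases_head h with h | ⟨z, hz, -⟩
        · exact h.symm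
        · exact (hx ⟨z, hz⟩).elim
      · rintro rfl
        exact SimpleGraph.Reachable.refl _
    rw [this]
    exact Rooted.single x

/-! ### Reduction of a rooted tree to a short path. -/

theorem Step.subset {V : Type*} [DecidableEq V] {G : SimpleGraph V} {R S : Finset V}
    (h : Step G R S) : R ⊆ S := by
  obtain ⟨q, hq, v, hv, ls, hl, hc, rfl⟩ := h
  exact Finset.subset_union_left

theorem subset_of_steps {V : Type*} [DecidableEq V] {G : SimpleGraph V} {R S : Finset V}
    (h : Relation.ReflTransGen (Step G) R S) : R ⊆ S := by
  induction h with
  | refl => exact subset_rfl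
  | tail _ hs ih => exact ih.trans hs.subset

/-- Steps are local: a set `Z` away from the added vertices can be carried along. This allows the
two halves of a join to be built one after the other. -/
theorem steps_union {V : Type*} [DecidableEq V] {G : SimpleGraph V} {R S Z : Finset V}
    (h : Relation.ReflTransGen (Step G) R S)
    (hZ : ∀ z ∈ Z, ∀ s ∈ S, s ∉ R → z ≠ s ∧ ¬ G.Adj z s) :
    Relation.ReflTransGen (Step G) (R ∪ Z) (S ∪ Z) := by
  induction h with
  | refl => exact Relation.ReflTransGen.refl
  | @tail S T hRS hST ih =>
    refine (ih fun z hz s hs => hZ z hz s (hST.subset hs)).tail ?_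
    have hR := subset_of_steps hRS
    obtain ⟨q, hq, v, hv, ls, hl, hc, rfl⟩ := hST
    refine ⟨q, hq, v, Finset.mem_union_left _ hv, ls, hl, ?_, Finset.union_right_comm _ _ _⟩
    intro r hr d hd
    rcases Finset.mem_union.1 hr with hr | hr
    · exact hc r hr d hd
    · have := hZ r hr d (Finset.mem_union_right _ (List.mem_toFinset.2 hd))
        fun h => (hc d (hR h) d hd).1 rfl
      exact ⟨this.1, fun h => (this.2 h).elim⟩

theorem glue_paths_mem_gadgets : ∀ i < 3, ∀ j < 3,
    glueParents (pathParents (i + 2)) (pathParents (j + 2)) 0 ∈ gadgets ∨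
    glueParents (pathParents (j + 2)) (pathParents (i + 2)) 0 ∈ gadgets := by
  decide +kernel

/-- A tree is obtained by attaching gadgets to a path with at most four vertices that ends at the
root. -/
theorem Rooted.exists_steps {V : Type*} [DecidableEq V] {G : SimpleGraph V} {S : Finset V} {x : V}
    (h : Rooted G S x) : ∃ ys : List V, ys.length ≤ 3 ∧
      Realizes G (pathParents (ys.length + 1)) (x :: ys) ∧
      Relation.ReflTransGen (Step G) (x :: ys).toFinset S := by
  induction h with
  | single x => exact ⟨[], by simp, Realizes.singleton G x, by simp [Relation.ReflTransGen.refl]⟩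
  | @join A B x y hA hB hdis hxy hc ihA ihB =>
    obtain ⟨as, hal, har, hat⟩ := ihA
    obtain ⟨bs, hbl, hbr, hbt⟩ := ihB
    have hAs : ∀ a ∈ x :: as, a ∈ A := fun a ha => subset_of_steps hat (List.mem_toFinset.2 ha)
    have hBs : ∀ b ∈ y :: bs, b ∈ B := fun b hb => subset_of_steps hbt (List.mem_toFinset.2 hb)
    have hne : ∀ a ∈ A, ∀ b ∈ B, a ≠ b := fun a ha b hb he =>
      Finset.disjoint_left.1 hdis ha (he ▸ hb)
    have hcons : Realizes G (pathParents (bs.length + 2)) (x :: y :: bs) := by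
      refine hbr.cons_path hxy ?_ ?_
      · exact fun hx => hne x hA.root_mem x (hBs x (List.mem_cons_of_mem _ hx)) rfl
      · intro d hd hxd
        obtain rfl := (hc x hA.root_mem d (hBs d (List.mem_cons_of_mem _ hd)) hxd).2
        exact (List.nodup_cons.1 hbr.nodup).1 hd
    have hcross : ∀ a ∈ A, ∀ b ∈ B, a ≠ b ∧ (G.Adj a b → a = x) := fun a ha b hb =>
      ⟨hne a ha b hb, fun hab => (hc a ha b hb hab).1⟩
    -- `A` is completed beside the path in `B`, then `B` beside all of `A`. The only edge across is
    -- `xy`, and both its ends are present from the start.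
    have hsteps : Relation.ReflTransGen (Step G) ((x :: as).toFinset ∪ (y :: bs).toFinset)
        (A ∪ B) := by
      refine (steps_union hat fun z hz s hs hsR => ?_).trans ?_
      · have hzB := hBs z (List.mem_toFinset.1 hz)
        refine ⟨(hne s hs z hzB).symm, fun hzs => hsR ?_⟩
        rw [(hc s hs z hzB hzs.symm).1]
        simp
      · rw [Finset.union_comm A, Finset.union_comm A]
        refine steps_union hbt fun z hz s hs hsR => ⟨hne z hz s hs, fun hzs => hsR ?_⟩
        rw [(hc z hz s hs hzs).2]
        simp
    -- The remainder is `x` with path branches `as` and `y :: bs`. If the latter has four vertices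
    -- it is a gadget by itself; if `as` is empty, `y :: bs` is the new short path; otherwise both
    -- have at most three vertices and form one gadget.
    by_cases hb3 : bs.length = 3
    · refine ⟨as, hal, har, Relation.ReflTransGen.head ?_ hsteps⟩
      refine ⟨pathParents 5, by decide, x, by simp, y :: bs, ?_, ?_, rfl⟩
      · simpa [hb3] using hcons
      · exact fun r hr d hd => hcross r (hAs r (List.mem_toFinset.1 hr)) d (hBs d hd)
    · rcases as with _ | ⟨a, as⟩
      · refine ⟨y :: bs, by simp; omega, hcons, ?_⟩
        have : (x :: y :: bs).toFinset = [x].toFinset ∪ (y :: bs).toFinset := by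
          rw [← List.toFinset_append]; rfl
        rw [this]
        exact hsteps
      · refine ⟨[], by simp, Realizes.singleton G x, Relation.ReflTransGen.head ?_ hsteps⟩
        have haA : ∀ r ∈ a :: as, r ∈ A := fun r hr => hAs r (List.mem_cons_of_mem _ hr)
        have hxa := (List.nodup_cons.1 har.nodup).1
        have hxb := (List.nodup_cons.1 hcons.nodup).1
        have hfirst : ∀ d ∈ a :: as ++ y :: bs,
            ∀ r ∈ [x].toFinset, r ≠ d ∧ (G.Adj r d → r = x) := by
          intro d hd r hr
          have hrx : r = x := by simpa using hr
          refine ⟨?_, fun _ => hrx⟩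
          rintro rfl
          rw [hrx] at hd
          rcases List.mem_append.1 hd with h | h
          · exact hxa h
          · exact hxb h
        simp only [List.length_cons] at hal har
        rcases glue_paths_mem_gadgets as.length (by omega) bs.length (by omega) with hg | hg
        · refine ⟨_, hg, x, by simp, a :: as ++ y :: bs, ?_, ?_, ?_⟩
          · exact har.glue (k := 0) hcons (by simp) rfl
              fun r hr d hd => hcross r (hAs r hr) d (hBs d hd)
          · exact fun r hr d hd => hfirst d hd r hr
          · rw [← List.toFinset_append, ← List.toFinset_append]; rfl
        -- The table lists each unordered pair of branch lengths once, so the branches may have to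
        -- be swapped.
        · refine ⟨_, hg, x, by simp, y :: bs ++ a :: as, ?_, ?_, ?_⟩
          · refine hcons.glue (k := 0) har (by simp) rfl fun r hr d hd => ?_
            rcases List.mem_cons.1 hr with rfl | hr
            · exact ⟨fun he => hxa (he ▸ hd), fun _ => rfl⟩
            · refine ⟨(hne d (haA d hd) r (hBs r hr)).symm, fun hrd => ?_⟩
              exact (hxa ((hc d (haA d hd) r (hBs r hr) hrd.symm).1 ▸ hd)).elim
          · exact fun r hr d hd => hfirst d (by simp at hd ⊢; tauto) r hr
          · ext v
            simp only [List.mem_toFinset, Finset.mem_union, List.mem_cons, List.mem_append,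
              List.mem_nil_iff]
            tauto

/-! ### Base case, cycle lengths and conclusion. -/

theorem starOn_or_wellPlaced_path {V : Type*} [DecidableEq V] {G : SimpleGraph V}
    (hG : G.Connected) {x : V} {ys : List V} (hl : ys.length ≤ 3)
    (h : Realizes G (pathParents (ys.length + 1)) (x :: ys)) :
    (∃ c, StarOn G (x :: ys).toFinset c) ∨ WellPlaced G (x :: ys).toFinset x := by
  match ys, hl, h with
  | [], _, _ => exact Or.inl ⟨x, by simp [StarOn]⟩
  | [a], _, h =>
    have hxa : G.Adj x a := by
      simpa [pathParents] using h.adj_iff 0 1 (by simp) (by simp) (by omega)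
    exact Or.inl ⟨x, by simp [StarOn, hxa, hxa.symm, hxa.ne, hxa.ne.symm]⟩
  | [a, b], _, h =>
    have hxa : G.Adj x a := by
      simpa [pathParents] using h.adj_iff 0 1 (by simp) (by simp) (by omega)
    have hab : G.Adj a b := by
      simpa [pathParents] using h.adj_iff 1 2 (by simp) (by simp) (by omega)
    have hxb : ¬ G.Adj x b := by
      simpa [pathParents] using h.adj_iff 0 2 (by simp) (by simp) (by omega)
    have hbx : ¬ G.Adj b x := fun h => hxb h.symm
    exact Or.inl ⟨a, by simp [StarOn, hxa, hxa.symm, hxa.ne, hxa.ne.symm, hab, hab.symm, hab.ne,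
      hab.ne.symm, hxb, hbx]⟩
  | [a, b, c], _, h =>
    -- The path with four vertices is self-complementary; this 4-cycle maps it onto its complement.
    have hp : IsWellPlacementList (pathParents 4) [1, 3, 0, 2] 0 := by decide +kernel
    exact Or.inr (hp.wellPlaced hG h (by simp))

theorem Rooted.starOn_or_wellPlaced {V : Type*} [DecidableEq V] {G : SimpleGraph V}
    (hG : G.Connected) {S : Finset V} {x : V} (h : Rooted G S x) :
    (∃ c, StarOn G S c) ∨ WellPlaced G S x := by
  obtain ⟨ys, hl, hr, hs⟩ := h.exists_steps
  have hx : x ∈ (x :: ys).toFinset := by simp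
  clear h
  induction hs with
  | refl => exact starOn_or_wellPlaced_path hG hl hr
  | tail hRS hST ih =>
    have hxS := subset_of_steps hRS hx
    rcases ih with ⟨c, hc⟩ | hw
    · exact hc.step hG hxS hST
    · exact Or.inr (hw.step hG hxS hST)

/-- A power of a cycle that fixes one point of its support is trivial, so the length divides some `k
+ 1 ≤ 5`. -/
theorem le_five_of_mem_cycleType {V : Type*} [Fintype V] [DecidableEq V] {σ : Equiv.Perm V}
    (h : ∀ v, ∃ k < 5, σ^[k + 1] v = v) {l : ℕ} (hl : l ∈ σ.cycleType) : l ≤ 5 := by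
  rw [Equiv.Perm.cycleType_def, Multiset.mem_map] at hl
  obtain ⟨c, hc, rfl⟩ := hl
  have hc' : c ∈ σ.cycleFactorsFinset := hc
  have hcyc := (Equiv.Perm.mem_cycleFactorsFinset_iff.1 hc').1
  obtain ⟨v, hv⟩ := hcyc.nonempty_support
  obtain ⟨k, hk, hkv⟩ := h v
  have hcv := Equiv.Perm.cycle_is_cycleOf hv hc'
  have hone : c ^ (k + 1) = 1 := by
    refine hcyc.pow_eq_one_iff.2 ⟨v, Equiv.Perm.mem_support.1 hv, ?_⟩
    rw [hcv, Equiv.Perm.cycleOf_pow_apply_self, ← Equiv.Perm.iterate_eq_pow]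
    exact hkv
  have := Nat.le_of_dvd (by omega) (orderOf_dvd_of_pow_eq_one hone)
  rw [hcyc.orderOf] at this
  exact this.trans (by omega)

end TreePacking

theorem theorem1p7 {V : Type*} [Fintype V] [DecidableEq V] (T : SimpleGraph V)
    [DecidableRel T.Adj] (hT : T.IsTree) (hstar : ¬ TreePacking.IsStar T) (x : V) :
    ∃ σ : Equiv.Perm V, TreePacking.IsWellTwoPlacement T x σ := by
  classical
  have hr := TreePacking.rooted_component T hT.isAcyclic x
  have hr' : TreePacking.Rooted T Finset.univ x := by
    convert hr
    ext v
    simp [hT.connected.preconnected x v]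
  rcases hr'.starOn_or_wellPlaced hT.connected with ⟨c, -, hc⟩ | ⟨σ, hσ, hx, hy⟩
  · exact (hstar ⟨c, fun u v => hc u (Finset.mem_univ u) v (Finset.mem_univ v)⟩).elim
  · refine ⟨σ, fun v => (hσ.ne_iff v).2 (Finset.mem_univ v), ?_, ?_, hx,
      fun y => hy y (Finset.mem_univ y), fun y _ => hσ.dist_le_four y (Finset.mem_univ y),
      fun l hl => TreePacking.le_five_of_mem_cycleType hσ.period hl⟩
    · refine Set.disjoint_left.2 fun e he he' => ?_
      induction e using Sym2.ind with
      | _ a b =>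
        obtain ⟨u, v, huv, rfl, rfl⟩ := (SimpleGraph.map_adj _ _ _ _).1 he'
        exact hσ.not_adj u (Finset.mem_univ u) v (Finset.mem_univ v) huv he
    · intro a b hab
      obtain ⟨u, v, huv, rfl, rfl⟩ := (SimpleGraph.map_adj _ _ _ _).1 hab
      exact ⟨σ.injective.ne huv.ne, hT.connected.preconnected _ _,
        hσ.dist_le_six u (Finset.mem_univ u) v (Finset.mem_univ v) huv⟩
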